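/- Let $\mathrm{gl}_{\infty|\infty}$ be the space of complex matrices $(a_{ij})_{i,j\in\frac12\mathbb Z}$ with $a_{ij}=0$ for $|j-i|\gg 0$, graded by $\frac12\mathbb Z$ so that the component of degree $p$ consists of the (possibly infinite) sums $\sum_{j}a_j e_{j-p,j}$, where $e_{ij}$ are the matrix units, and made into a Lie superalgebra by $[A,B]=AB-(-1)^{4\deg A\deg B}BA$ for homogeneous $A,B$. Let $\widehat{\mathrm{gl}}_{\infty|\infty}=\mathrm{gl}_{\infty|\infty}\oplus\mathbb C C$ be its central extension by the even element $C$ of degree $0$ with the two-cocycle $\alpha(A,B)=\mathrm{Str}([J,A]B)$, where $J=\sum_{r\le 0}e_{rr}$ and $\mathrm{Str}(D)=\sum_{r\in\frac12\mathbb Z}(-1)^{2r}d_{rr}$. Write $\mathfrak g=\widehat{\mathrm{gl}}_{\infty|\infty}=\bigoplus_{p\in\frac12\mathbb Z}\mathfrak g_p$, $\mathfrak g_\pm=\bigoplus_{p>0}\mathfrak g_{\pm p}$, and define $\omega_s,\Lambda_0\in\mathfrak g_0^*$ ($s\in\frac12\mathbb Z$) by $\omega_s(\sum_r a_re_{rr}+dC)=a_s$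 and $\Lambda_0(\sum_r a_re_{rr}+dC)=d$. Let $M$ be an irreducible highest weight $\mathfrak g$-module with highest weight $\xi\in\mathfrak g_0^*$ and nonzero highest weight vector $v_\xi$, i.e. $hv_\xi=\xi(h)v_\xi$ for all $h\in\mathfrak g_0$, $\mathfrak g_+v_\xi=0$ and $U(\mathfrak g_-)v_\xi=M$. Give $M$ its natural $\frac12\mathbb Z$-grading $M=\bigoplus_j M_j$ in which $v_\xi$ has degree $0$ and $\mathfrak g_iM_j\subseteq M_{i+j}$. Then the following are equivalent: (i) $M$ is quasi-finite, i.e. $\dim M_j<\infty$ for all $j\in\frac12\mathbb Z$; (ii) $\mathfrak g_{-1/2}\,v_\xi$ is finite dimensional; (iii) there exist $N\in\mathbb N$ and complex numbers $\xi_j$ ($j\in\frac12\mathbb Z$, $|j|\le N$) and $d$ such that $\xi=\sum_{|j|\le N}\xi_j\omega_j+d\Lambda_0$. -/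

import Mathlib

/-!
Throughout, half-integers are encoded by their doubles: the integer `i : ℤ` stands for the
half-integer `i / 2`.  Thus the basis vector `e_{i/2}` is even (odd) iff `i` is even (odd), a degree
`p / 2` is recorded as `p : ℤ`, and degree `-1/2` is recorded as `-1`.
-/

noncomputable section

namespace SuperGl

/-- The space underlying the Lie superalgebra of infinite matrices `(a_{ij})`, with rows and columns
indexed by half-integers, such that `a_{ij} = 0` for `|j - i| ≫ 0`. -/
def gl : Submodule ℂ (Matrix ℤ ℤ ℂ) where
  carrier := {A | ∃ b : ℤ, ∀ i j : ℤ, b < |j - i| → A i j = 0}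
  zero_mem' := ⟨0, fun _ _ _ => rfl⟩
  add_mem' := by
    rintro A B ⟨b, hb⟩ ⟨c, hc⟩
    refine ⟨max b c, fun i j h => ?_⟩
    rw [Matrix.add_apply, hb i j ((le_max_left _ _).trans_lt h),
      hc i j ((le_max_right _ _).trans_lt h), add_zero]
  smul_mem' := by
    rintro r A ⟨b, hb⟩
    exact ⟨b, fun i j h => by rw [Matrix.smul_apply, hb i j h, smul_zero]⟩

/-- The product of infinite matrices (for matrices in `gl` each sum has finitely many terms). -/
def mulInf (A B : Matrix ℤ ℤ ℂ) : Matrix ℤ ℤ ℂ :=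
  fun i j => ∑ᶠ k : ℤ, A i k * B k j

/-- The matrices of degree `p`, i.e. the (possibly infinite) combinations of the `e_{j-p,j}`. -/
def matDeg (p : ℤ) : Submodule ℂ (Matrix ℤ ℤ ℂ) where
  carrier := {A | ∀ i j : ℤ, i ≠ j - p → A i j = 0}
  zero_mem' := fun _ _ _ => rfl
  add_mem' := by
    intro A B hA hB i j h
    rw [Matrix.add_apply, hA i j h, hB i j h, add_zero]
  smul_mem' := by
    intro r A hA i j h
    rw [Matrix.smul_apply, hA i j h, smul_zero]

/-- The super-bracket: the bilinear extension of `AB - (-1)^{|A||B|} BA`.  The matrix unit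
`e_{ij}` has parity `i - j` (mod 2) in the doubled indices. -/
def superBracket (A B : Matrix ℤ ℤ ℂ) : Matrix ℤ ℤ ℂ :=
  fun i j => ∑ᶠ k : ℤ, (A i k * B k j - (-1 : ℂ) ^ ((i - k) * (k - j)) * (B i k * A k j))

/-- On homogeneous matrices the super-bracket is the usual super-commutator. -/
theorem superBracket_of_mem_matDeg {p q : ℤ} {A B : Matrix ℤ ℤ ℂ} (hA : A ∈ matDeg p)
    (hB : B ∈ matDeg q) :
    superBracket A B = mulInf A B - (-1 : ℂ) ^ (p * q) • mulInf B A := by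
  ext i j
  have h1 : (Function.support fun k : ℤ => A i k * B k j).Finite := by
    refine (Set.finite_singleton (i + p)).subset fun k hk => ?_
    by_contra hne
    refine hk ?_
    change A i k * B k j = 0
    rw [hA i k (fun h => hne (by rw [Set.mem_singleton_iff]; omega)), zero_mul]
  have h2 : (Function.support fun k : ℤ => (-1 : ℂ) ^ (p * q) * (B i k * A k j)).Finite := by
    refine (Set.finite_singleton (i + q)).subset fun k hk => ?_
    by_contra hne
    refine hk ?_
    change (-1 : ℂ) ^ (p * q) * (B i k * A k j) = 0
    rw [hB i k (fun h => hne (by rw [Set.mem_singleton_iff]; omega)), zero_mul, mul_zero]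
  have h3 : ∀ k : ℤ, (-1 : ℂ) ^ ((i - k) * (k - j)) * (B i k * A k j)
      = (-1 : ℂ) ^ (p * q) * (B i k * A k j) := by
    intro k
    by_cases hk : i = k - q
    · by_cases hk' : k = j - p
      · have e1 : i - k = -q := by omega
        have e2 : k - j = -p := by omega
        rw [e1, e2, neg_mul_neg, mul_comm q p]
      · rw [hA k j hk', mul_zero, mul_zero, mul_zero]
    · rw [hB i k hk, zero_mul, mul_zero, mul_zero]
  have h4 : (∑ᶠ k : ℤ, (-1 : ℂ) ^ (p * q) * (B i k * A k j))
      = (-1 : ℂ) ^ (p * q) * ∑ᶠ k : ℤ, B i k * A k j :=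
    (smul_finsum ((-1 : ℂ) ^ (p * q)) (fun k : ℤ => B i k * A k j)).symm
  simp only [superBracket, h3, Matrix.sub_apply, Matrix.smul_apply, mulInf, smul_eq_mul]
  rw [finsum_sub_distrib h1 h2, h4]

theorem superBracket_mem_gl {A B : Matrix ℤ ℤ ℂ} (hA : A ∈ gl) (hB : B ∈ gl) :
    superBracket A B ∈ gl := by
  obtain ⟨b, hb⟩ := hA
  obtain ⟨c, hc⟩ := hB
  refine ⟨b + c, fun i j h => ?_⟩
  have key : ∀ k : ℤ, A i k * B k j - (-1 : ℂ) ^ ((i - k) * (k - j)) * (B i k * A k j) = 0 := by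
    intro k
    have tri : |j - i| ≤ |k - i| + |j - k| := by
      have := abs_add_le (k - i) (j - k)
      rwa [show k - i + (j - k) = j - i by ring] at this
    have z1 : A i k * B k j = 0 := by
      by_cases hk : b < |k - i|
      · rw [hb i k hk, zero_mul]
      · rw [hc k j (by linarith), mul_zero]
    have z2 : B i k * A k j = 0 := by
      by_cases hk : c < |k - i|
      · rw [hc i k hk, zero_mul]
      · rw [hb k j (by linarith), mul_zero]
    rw [z1, z2, mul_zero, sub_zero]
  simp only [superBracket, key, finsum_zero]

/-- The supertrace `∑ (-1)^{2r} d_{rr}` (used for matrices with finitely many nonzero diagonal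
entries). -/
def str (D : Matrix ℤ ℤ ℂ) : ℂ := ∑ᶠ r : ℤ, (-1 : ℂ) ^ r * D r r

/-- The matrix `J = ∑_{r ≤ 0} e_{rr}`. -/
def matJ : Matrix ℤ ℤ ℂ := Matrix.diagonal fun r => if r ≤ 0 then 1 else 0

/-- The two-cocycle `α(A, B) = Str([J, A] B)`. -/
def cocycle (A B : Matrix ℤ ℤ ℂ) : ℂ := str (mulInf (superBracket matJ A) B)

/-- The central extension of `gl`; the pair `(A, c)` is `A + c C` with `C` the central element. -/
abbrev HatGl : Type := gl × ℂ

/-- The super-bracket of the central extension, `[A + a C, B + b C] = [A, B] + α(A, B) C`. -/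
def hatBracket (x y : HatGl) : HatGl :=
  (⟨superBracket x.1 y.1, superBracket_mem_gl x.1.2 y.1.2⟩, cocycle x.1 y.1)

/-- The homogeneous component of degree `p` of the central extension; `C` has degree `0`. -/
def hatDeg (p : ℤ) : Submodule ℂ HatGl where
  carrier := {x | (x.1 : Matrix ℤ ℤ ℂ) ∈ matDeg p ∧ (p ≠ 0 → x.2 = 0)}
  zero_mem' := ⟨(matDeg p).zero_mem, fun _ => rfl⟩
  add_mem' := by
    rintro x y ⟨hx, hx'⟩ ⟨hy, hy'⟩
    exact ⟨(matDeg p).add_mem hx hy, fun h => by rw [Prod.snd_add, hx' h, hy' h, add_zero]⟩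
  smul_mem' := by
    rintro r x ⟨hx, hx'⟩
    exact ⟨(matDeg p).smul_mem r hx, fun h => by rw [Prod.smul_snd, hx' h, smul_zero]⟩

/-- `𝔤₊`, the sum of the components of positive degree. -/
def hatPos : Submodule ℂ HatGl := ⨆ p : {p : ℤ // 0 < p}, hatDeg p

/-- `𝔤₋`, the sum of the components of negative degree. -/
def hatNeg : Submodule ℂ HatGl := ⨆ p : {p : ℤ // p < 0}, hatDeg p

/-- The fundamental weight `ω_s (∑ a_r e_{rr} + d C) = a_s`. -/
def omega (s : ℤ) : Module.Dual ℂ (hatDeg 0) where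
  toFun h := (h.1.1 : Matrix ℤ ℤ ℂ) s s
  map_add' _ _ := rfl
  map_smul' _ _ := rfl

/-- The fundamental weight `Λ₀ (∑ a_r e_{rr} + d C) = d`. -/
def Lambda0 : Module.Dual ℂ (hatDeg 0) where
  toFun h := h.1.2
  map_add' _ _ := rfl
  map_smul' _ _ := rfl

/-- A module over the Lie superalgebra `HatGl` on the complex vector space `M`. -/
structure HatGlModule (M : Type*) [AddCommGroup M] [Module ℂ M] where
  /-- the action -/
  act : HatGl →ₗ[ℂ] Module.End ℂ M
  act_bracket : ∀ (p q : ℤ) (x y : HatGl), x ∈ hatDeg p → y ∈ hatDeg q →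
    act (hatBracket x y) = act x * act y - (-1 : ℂ) ^ (p * q) • (act y * act x)

namespace HatGlModule

variable {M : Type*} [AddCommGroup M] [Module ℂ M] (V : HatGlModule M)

/-- `M` is nonzero and has no submodules other than `0` and `M`. -/
def IsIrreducible : Prop :=
  Nontrivial M ∧
    ∀ W : Submodule ℂ M, (∀ x : HatGl, ∀ w ∈ W, V.act x w ∈ W) → W = ⊥ ∨ W = ⊤

/-- `v` is a highest weight vector of highest weight `ξ`, and `M` is a highest weight module
generated by it, `M = U(𝔤₋) v`. The image of `U(𝔤₋)` in `End M` is the unital subalgebra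
generated by the operators of `𝔤₋`. -/
structure IsHighestWeight (ξ : Module.Dual ℂ (hatDeg 0)) (v : M) : Prop where
  ne_zero : v ≠ 0
  weight : ∀ h : hatDeg 0, V.act h v = ξ h • v
  pos : ∀ x ∈ hatPos, V.act x v = 0
  gen : ∀ m : M, ∃ a ∈ Algebra.adjoin ℂ (V.act '' (hatNeg : Set HatGl)), a v = m

/-- The family `𝓜` is a (doubled) half-integer grading of the module: `M = ⨁ 𝓜 j` and
`𝔤_i 𝓜 j ⊆ 𝓜 (i + j)`. -/
def IsGrading (𝓜 : ℤ → Submodule ℂ M) : Prop :=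
  DirectSum.IsInternal 𝓜 ∧
    ∀ i j : ℤ, ∀ x ∈ hatDeg i, ∀ m ∈ 𝓜 j, V.act x m ∈ 𝓜 (i + j)

/-- The natural grading of a module generated by `v`, with `v` in degree `0`: the component of
degree `n` is spanned by the vectors `x₁ ⋯ x_k v` with the `x_i` homogeneous of total degree
`n`. -/
def naturalGrading (v : M) (n : ℤ) : Submodule ℂ M :=
  Submodule.span ℂ {m | ∃ l : List (ℤ × HatGl), (∀ y ∈ l, y.2 ∈ hatDeg y.1) ∧
    (l.map Prod.fst).sum = n ∧ (l.map fun y => V.act y.2).prod v = m}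

/-- A highest weight module with highest weight vector `v` is quasi-finite if all homogeneous
components of its natural grading are finite dimensional. -/
def IsQuasiFinite (v : M) : Prop := ∀ n : ℤ, FiniteDimensional ℂ (V.naturalGrading v n)

/-- The subspace `𝔤_p v`. -/
def degApply (p : ℤ) (v : M) : Submodule ℂ M := (hatDeg p).map (V.act.flip v)

/-- The diagonal matrix whose adjoint action is the degree. -/
def degElt : HatGl :=
  (⟨Matrix.diagonal fun r => -(r : ℂ), 0, fun i j h =>
    Matrix.diagonal_apply_ne _ (fun e => by simp [e] at h)⟩, 0)

theorem degElt_mem : degElt ∈ hatDeg 0 :=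
  ⟨fun i j h => Matrix.diagonal_apply_ne _ (fun e => h (by omega)), fun h => (h rfl).elim⟩

theorem hatBracket_degElt {p : ℤ} {x : HatGl} (hx : x ∈ hatDeg p) :
    hatBracket degElt x = (p : ℂ) • x := by
  have hJ : superBracket matJ (degElt.1 : Matrix ℤ ℤ ℂ) = 0 := by
    ext i j
    change (∑ᶠ k : ℤ, _) = (0 : ℂ)
    rw [← finsum_zero (α := ℤ)]
    congr 1
    ext k
    simp only [matJ, degElt, Matrix.diagonal_apply]
    by_cases h1 : i = k
    · by_cases h2 : k = j
      · subst h1 h2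
        simp [mul_comm]
      · simp [h2]
    · simp [h1]
  have h2 : (hatBracket degElt x).2 = 0 := by
    simp [hatBracket, cocycle, hJ, str, mulInf]
  have h1 : superBracket degElt.1 x.1 = (p : ℂ) • (x.1 : Matrix ℤ ℤ ℂ) := by
    rw [superBracket_of_mem_matDeg degElt_mem.1 hx.1]
    ext i j
    have e1 : mulInf degElt.1 x.1 i j = -(i : ℂ) * (x.1 : Matrix ℤ ℤ ℂ) i j := by
      rw [mulInf, finsum_eq_single _ i]
      · simp [degElt]
      · intro k hk
        simp [degElt, Matrix.diagonal_apply_ne _ hk.symm]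
    have e2 : mulInf x.1 degElt.1 i j = (x.1 : Matrix ℤ ℤ ℂ) i j * -(j : ℂ) := by
      rw [mulInf, finsum_eq_single _ j]
      · simp [degElt]
      · intro k hk
        simp [degElt, Matrix.diagonal_apply_ne _ hk]
    rw [Matrix.sub_apply, Matrix.smul_apply, Matrix.smul_apply, e1, e2]
    by_cases h : i = j - p
    · subst h
      simp only [zero_mul, zpow_zero, smul_eq_mul]
      push_cast
      ring
    · rw [hx.1 i j h]
      simp
  refine Prod.ext (Subtype.ext h1) (h2.trans ?_)
  by_cases hp : p = 0
  · simp [hp]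
  · simp [hx.2 hp]

/-- The natural grading of a highest weight module is indeed a grading. -/
theorem naturalGrading_isGrading {ξ : Module.Dual ℂ (hatDeg 0)} {v : M}
    (hv : V.IsHighestWeight ξ v) : V.IsGrading (V.naturalGrading v) := by
  have hstab : ∀ i j : ℤ, ∀ x ∈ hatDeg i, ∀ m ∈ V.naturalGrading v j,
      V.act x m ∈ V.naturalGrading v (i + j) := by
    intro i j x hx m hm
    rw [naturalGrading] at hm
    induction hm using Submodule.span_induction with
    | mem m hm =>
      obtain ⟨l, hl, hs, rfl⟩ := hm
      refine Submodule.subset_span ⟨(i, x) :: l, ?_, by simp [hs], by simp⟩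
      intro y hy
      rcases List.mem_cons.1 hy with rfl | hy
      · exact hx
      · exact hl y hy
    | zero => rw [map_zero]; exact Submodule.zero_mem _
    | add a b _ _ ha hb => rw [map_add]; exact Submodule.add_mem _ ha hb
    | smul r a _ ha => rw [map_smul]; exact Submodule.smul_mem _ r ha
  refine ⟨?_, hstab⟩
  have hle : ∀ n, V.naturalGrading v n ≤
      Module.End.eigenspace (V.act degElt) (ξ ⟨degElt, degElt_mem⟩ + n) := by
    intro n
    refine Submodule.span_le.2 ?_
    rintro m ⟨l, hl, hs, rfl⟩
    rw [SetLike.mem_coe, Module.End.mem_eigenspace_iff]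
    induction l generalizing n with
    | nil =>
      have := hv.weight ⟨degElt, degElt_mem⟩
      simp only [List.map_nil, List.sum_nil] at hs
      simpa [← hs] using this
    | cons y l ih =>
      have ih' := ih _ (fun z hz => hl z (List.mem_cons_of_mem _ hz)) rfl
      have hy := hl y List.mem_cons_self
      have hb := V.act_bracket 0 y.1 degElt y.2 degElt_mem hy
      rw [hatBracket_degElt hy, zero_mul, zpow_zero, one_smul, map_smul, eq_sub_iff_add_eq] at hb
      have hb' := LinearMap.congr_fun hb ((l.map fun y => V.act y.2).prod v)
      simp only [LinearMap.add_apply, LinearMap.smul_apply, Module.End.mul_apply] at hb'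
      simp only [List.map_cons, List.prod_cons, Module.End.mul_apply, List.sum_cons] at hs ⊢
      rw [← hb', ih', map_smul, ← add_smul, ← hs]
      push_cast
      congr 1
      ring
  rw [DirectSum.isInternal_submodule_iff_iSupIndep_and_iSup_eq_top]
  constructor
  · refine iSupIndep.mono ((Module.End.eigenspaces_iSupIndep (V.act degElt)).comp
      (f := fun n : ℤ => ξ ⟨degElt, degElt_mem⟩ + (n : ℂ)) ?_) hle
    intro a b hab
    exact_mod_cast add_left_cancel hab
  · rw [eq_top_iff]
    have hneg : ∀ x ∈ hatNeg, ∀ m ∈ ⨆ n, V.naturalGrading v n,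
        V.act x m ∈ ⨆ n, V.naturalGrading v n := by
      intro x hx m hm
      rw [hatNeg] at hx
      induction hx using Submodule.iSup_induction' with
      | mem p x hx =>
        induction hm using Submodule.iSup_induction' with
        | mem n m hm => exact Submodule.mem_iSup_of_mem _ (hstab _ _ x hx m hm)
        | zero => rw [map_zero]; exact Submodule.zero_mem _
        | add a b _ _ ha hb => rw [map_add]; exact Submodule.add_mem _ ha hb
      | zero => rw [map_zero]; exact Submodule.zero_mem _
      | add a b _ _ ha hb =>
        rw [map_add, LinearMap.add_apply]; exact Submodule.add_mem _ ha hb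
    rintro m -
    obtain ⟨a, ha, rfl⟩ := hv.gen m
    have key : ∀ w ∈ ⨆ n, V.naturalGrading v n, a w ∈ ⨆ n, V.naturalGrading v n := by
      induction ha using Algebra.adjoin_induction with
      | mem a ha =>
        obtain ⟨x, hx, rfl⟩ := ha
        exact hneg x hx
      | algebraMap r =>
        intro w hw
        rw [Module.algebraMap_end_apply]
        exact Submodule.smul_mem _ r hw
      | add a b _ _ ha hb => exact fun w hw => Submodule.add_mem _ (ha w hw) (hb w hw)
      | mul a b _ _ ha hb => exact fun w hw => ha _ (hb w hw)
    exact key v (Submodule.mem_iSup_of_mem 0 (Submodule.subset_span ⟨[], by simp, rfl, rfl⟩))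

end HatGlModule

end SuperGl

end

/-!
All three conditions say that only a finite window of the infinite matrices matters. The integer
degrees and indices `n`, `p`, `j` below are doubled, as in the code.

*Finite-dimensionality in degree `-1/2` forces a finite weight.* If `𝔤_{-1/2} v` is
finite-dimensional, then some element `A` of `𝔤_{-1/2}` whose entries are the values `P(j)` of a
nonzero polynomial kills `v` (`exists_polynomial_act_eq_zero`). For `B` in `𝔤_{1/2}` the
anticommutator `[B, A]` kills `v` too, so `ξ` vanishes on it. As `P` has finitely many roots, the
products `c_j = P(j) b_{j+1}` are arbitrary outside a window, and the diagonal of `[B, A]` is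
`c_j + c_{j-1}`, which is again arbitrary outside a window; hence `ξ` vanishes on the diagonal
matrices supported outside it (`weight_eq_zero_of_mem_tailDeg`).

*A finite weight gives a quasi-finite module.* Let `A` have degree `-n < 0` and vanish on a large
window. The bracket of `A` with an element of `𝔤₊` has higher degree and vanishes on a slightly
smaller window, so by induction on `n` it kills `v`; thus `𝔤₊ A v = 0`, and irreducibility gives
`A v = 0` (`eq_zero_of_singular`, `exists_tailDeg_act_eq_zero`). The vectors killed, in each degree,
by all elements vanishing on some window form a submodule containing `v`, hence all of `M`
(`exists_tailDeg_act_eq_zero_of_vector`). So `𝔤_p w` is finite-dimensional for all `p` and `w`, and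
the components of `M`, being spanned by words with letters of negative degree
(`naturalGrading_eq_wordSpan`), are finite-dimensional by induction on the degree.
-/

noncomputable section

namespace SuperGl

/-! ### Homogeneous elements, brackets and the cocycle -/

theorem superBracket_mem_matDeg {p q : ℤ} {A B : Matrix ℤ ℤ ℂ} (hA : A ∈ matDeg p)
    (hB : B ∈ matDeg q) : superBracket A B ∈ matDeg (p + q) := by
  intro i j h
  change (∑ᶠ k : ℤ, _) = (0 : ℂ)
  rw [← finsum_zero (α := ℤ)]
  congr 1
  ext k
  have z1 : A i k * B k j = 0 := by
    by_cases hk : k = j - q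
    · rw [hA i k (by omega), zero_mul]
    · rw [hB k j hk, mul_zero]
  have z2 : B i k * A k j = 0 := by
    by_cases hk : k = j - p
    · rw [hB i k (by omega), zero_mul]
    · rw [hA k j hk, mul_zero]
  rw [z1, z2, mul_zero, sub_zero]

theorem superBracket_diagonal_apply (d : ℤ → ℂ) (A : Matrix ℤ ℤ ℂ) (i j : ℤ) :
    superBracket (Matrix.diagonal d) A i j = (d i - d j) * A i j := by
  have h : ∀ k : ℤ, Matrix.diagonal d i k * A k j
      - (-1 : ℂ) ^ ((i - k) * (k - j)) * (A i k * Matrix.diagonal d k j)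
      = (if k = i then d i * A i j else 0) - (if k = j then d j * A i j else 0) := by
    intro k
    congr 1
    · by_cases hk : k = i
      · subst hk; simp
      · simp [Matrix.diagonal_apply_ne' _ hk, hk]
    · by_cases hk : k = j
      · subst hk; simp [mul_comm]
      · simp [hk]
  simp only [superBracket, h]
  rw [finsum_sub_distrib, finsum_eq_single _ i, finsum_eq_single _ j]
  · simp [sub_mul]
  · intro k hk; simp [hk]
  · intro k hk; simp [hk]
  · exact (Set.finite_singleton i).subset fun k hk => by
      by_contra hne
      exact hk (if_neg hne)
  · exact (Set.finite_singleton j).subset fun k hk => by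
      by_contra hne
      exact hk (if_neg hne)

/-- The coefficient of `[J, A]` at `(r, k)` vanishes unless `r` and `k` are separated by the cut
between `0` and `1`, so the cocycle only sees a finite window of the matrices. -/
theorem cocycle_eq_zero {p : ℤ} {A B : Matrix ℤ ℤ ℂ} (hA : A ∈ matDeg p)
    (h : ∀ r : ℤ, |r| ≤ |p| → B (r + p) r = 0) : cocycle A B = 0 := by
  have key : ∀ r k : ℤ, superBracket matJ A r k * B k r = 0 := by
    intro r k
    rw [matJ, superBracket_diagonal_apply]
    by_cases hk : r = k - p
    · by_cases hr : |r| ≤ |p|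
      · rw [show k = r + p by omega, h r hr, mul_zero]
      · have : (if r ≤ 0 then (1 : ℂ) else 0) = if k ≤ 0 then 1 else 0 := by
          congr 1
          refine propext ?_
          have h1 := neg_abs_le p
          have h2 := le_abs_self p
          rw [abs_le] at hr
          omega
        rw [this, sub_self, zero_mul, zero_mul]
    · rw [hA r k hk, mul_zero, zero_mul]
  simp only [cocycle, str, mulInf, key, finsum_zero, mul_zero]

theorem hatBracket_mem_hatDeg {p q : ℤ} {x y : HatGl} (hx : x ∈ hatDeg p) (hy : y ∈ hatDeg q) :
    hatBracket x y ∈ hatDeg (p + q) :=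
  ⟨superBracket_mem_matDeg hx.1 hy.1, fun h =>
    cocycle_eq_zero hx.1 fun r _ => hy.1 _ _ (by omega)⟩

/-! ### Matrices supported on one diagonal -/

/-- The element `∑ j, a j e_{j-p,j}` of degree `p`, with central part `0`. -/
def band (p : ℤ) : (ℤ → ℂ) →ₗ[ℂ] HatGl where
  toFun a := (⟨fun i j => if i = j - p then a j else 0, |p|, fun i j h => if_neg fun e => by
    rw [e, sub_sub_cancel] at h
    exact lt_irrefl _ h⟩, 0)
  map_add' a b := by
    refine Prod.ext (Subtype.ext ?_) (by simp)
    ext i j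
    change (if i = j - p then a j + b j else 0)
      = (if i = j - p then a j else 0) + if i = j - p then b j else 0
    split_ifs <;> simp
  map_smul' r a := by
    refine Prod.ext (Subtype.ext ?_) (by simp)
    ext i j
    change (if i = j - p then r * a j else 0) = r * if i = j - p then a j else 0
    split_ifs <;> simp

theorem band_apply (p : ℤ) (a : ℤ → ℂ) (i j : ℤ) :
    ((band p a).1 : Matrix ℤ ℤ ℂ) i j = if i = j - p then a j else 0 := rfl

theorem band_snd (p : ℤ) (a : ℤ → ℂ) : (band p a).2 = 0 := rfl

theorem band_mem (p : ℤ) (a : ℤ → ℂ) : band p a ∈ hatDeg p :=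
  ⟨fun _ _ h => if_neg h, fun _ => rfl⟩

theorem eq_band {p : ℤ} {x : HatGl} (hx : x ∈ hatDeg p) :
    x = band p (fun j => (x.1 : Matrix ℤ ℤ ℂ) (j - p) j) + (0, x.2) := by
  refine Prod.ext (Subtype.ext ?_) (by simp [band_snd])
  ext i j
  rw [Prod.fst_add, add_zero, band_apply]
  split_ifs with h
  · rw [h]
  · exact hx.1 i j h

theorem mulInf_band (p q : ℤ) (a b : ℤ → ℂ) :
    mulInf (band p a).1 (band q b).1 = (band (p + q) (fun j => a (j - q) * b j)).1 := by
  ext i j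
  rw [mulInf, finsum_eq_single _ (j - q)]
  · simp only [band_apply, if_true]
    by_cases h : i = j - q - p
    · rw [if_pos h, if_pos (by omega)]
    · rw [if_neg h, if_neg (by omega), zero_mul]
  · intro k hk
    rw [band_apply q, if_neg hk, mul_zero]

theorem superBracket_matJ_band (p : ℤ) (a : ℤ → ℂ) : superBracket matJ (band p a).1
    = (band p (fun j => ((if j - p ≤ 0 then 1 else 0) - (if j ≤ 0 then 1 else 0)) * a j)).1 := by
  ext i j
  rw [matJ, superBracket_diagonal_apply, band_apply, band_apply]
  split_ifs with h <;> simp_all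

/-- The bracket of an element of degree `1/2` with one of degree `-1/2`; both are odd, so it is an
anticommutator. -/
theorem hatBracket_band_one_neg_one (a b : ℤ → ℂ) : hatBracket (band 1 b) (band (-1) a)
    = band 0 (fun j => a j * b (j + 1) + a (j - 1) * b j) + (0, a 0 * b 1) := by
  refine Prod.ext (Subtype.ext ?_) ?_
  · have h := superBracket_of_mem_matDeg (band_mem 1 b).1 (band_mem (-1) a).1
    rw [mulInf_band, mulInf_band] at h
    refine h.trans ?_
    ext i j
    simp only [Matrix.sub_apply, Matrix.smul_apply, Prod.fst_add, add_zero, band_apply]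
    by_cases h : i = j
    · simp [h]; ring
    · simp [h]
  · simp only [hatBracket, cocycle, superBracket_matJ_band, mulInf_band, str, Prod.snd_add,
      band_snd, zero_add]
    rw [finsum_eq_single _ 0]
    · simp [band_apply, mul_comm]
    · intro r hr
      rw [band_apply]
      have : (if r - -1 - 1 ≤ 0 then (1 : ℂ) else 0) - (if r - -1 ≤ 0 then 1 else 0) = 0 := by
        by_cases h : r ≤ 0
        · rw [if_pos (by omega), if_pos (by omega), sub_self]
        · rw [if_neg (by omega), if_neg (by omega), sub_self]
      simp only [this, zero_mul, ite_self, mul_zero]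

/-- Banded matrices have finitely many nonzero diagonals, so the homogeneous components span. -/
theorem iSup_hatDeg : ⨆ p : ℤ, hatDeg p = ⊤ := by
  rw [eq_top_iff]
  rintro ⟨⟨A, b, hb⟩, c⟩ -
  have : ((⟨A, b, hb⟩, c) : HatGl)
      = ∑ p ∈ Finset.Icc (-b) b, band p (fun j => A (j - p) j) + (0, c) := by
    refine Prod.ext (Subtype.ext ?_) (by simp [Prod.snd_sum, band_snd])
    ext i j
    simp only [Prod.fst_add, Prod.fst_sum, add_zero, AddSubmonoidClass.coe_finsetSum,
      Matrix.sum_apply, band_apply]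
    rw [Finset.sum_eq_single (j - i)]
    · simp
    · intro p _ hp
      exact if_neg (by omega)
    · intro hp
      rw [if_pos (by omega), sub_sub_cancel]
      refine hb i j (lt_of_not_ge fun h => hp ?_)
      rwa [Finset.mem_Icc, ← abs_le]
  rw [this]
  refine add_mem (sum_mem fun p _ => Submodule.mem_iSup_of_mem p (band_mem _ _))
    (Submodule.mem_iSup_of_mem 0 ⟨fun _ _ _ => rfl, fun h => (h rfl).elim⟩)

/-- The elements of degree `p` with central part `0` whose columns in `[-L, L]` vanish. -/
def tailDeg (p : ℤ) (L : ℕ) : Set HatGl :=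
  {x | x ∈ hatDeg p ∧ x.2 = 0 ∧ ∀ i j : ℤ, |j| ≤ L → (x.1 : Matrix ℤ ℤ ℂ) i j = 0}

theorem tailDeg_anti (p : ℤ) {L L' : ℕ} (h : L ≤ L') : tailDeg p L' ⊆ tailDeg p L :=
  fun _ hx => ⟨hx.1, hx.2.1, fun i j hj => hx.2.2 i j (hj.trans (by exact_mod_cast h))⟩

/-- Removing the finitely many entries in a window and the central part leaves an element of
`tailDeg`. -/
theorem sub_window_mem_tailDeg {p : ℤ} (L : ℕ) {x : HatGl} (hx : x ∈ hatDeg p) :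
    x - (∑ j ∈ Finset.Icc (-L : ℤ) L, (x.1 : Matrix ℤ ℤ ℂ) (j - p) j • band p (Pi.single j 1)
      + x.2 • (0, 1)) ∈ tailDeg p L := by
  have hc : x.2 • ((0, 1) : HatGl) ∈ hatDeg p :=
    ⟨by rw [Prod.smul_fst, smul_zero]; exact Submodule.zero_mem _,
      fun h => by rw [Prod.smul_snd, hx.2 h, zero_smul]⟩
  have hmem := Submodule.sub_mem _ hx (Submodule.add_mem _ (Submodule.sum_mem _
    fun j (_ : j ∈ Finset.Icc (-L : ℤ) L) => Submodule.smul_mem _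
      ((x.1 : Matrix ℤ ℤ ℂ) (j - p) j) (band_mem p (Pi.single j 1))) hc)
  refine ⟨hmem, by simp [Prod.snd_sum, band_snd], fun i j hj => ?_⟩
  by_cases hij : i = j - p
  · rw [abs_le] at hj
    subst hij
    simp [Prod.fst_sum, Matrix.sum_apply, band_apply, Pi.single_apply, hj.1, hj.2]
  · exact hmem.1 i j hij

/-- Bracketing with a homogeneous element preserves vanishing on a window, up to shrinking it. -/
theorem hatBracket_mem_tailDeg {p q : ℤ} {L : ℕ} {x y : HatGl} (hx : x ∈ hatDeg q)
    (hy : y ∈ tailDeg p (L + q.natAbs)) : hatBracket x y ∈ tailDeg (q + p) L := by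
  have hL : ((L + q.natAbs : ℕ) : ℤ) = L + |q| := by push_cast; rfl
  refine ⟨hatBracket_mem_hatDeg hx hy.1, cocycle_eq_zero hx.1 fun r hr => hy.2.2 _ _ ?_,
    fun i j hj => ?_⟩
  · rw [hL]; linarith [Int.natCast_nonneg L]
  · change (∑ᶠ k : ℤ, _) = (0 : ℂ)
    rw [← finsum_zero (α := ℤ)]
    congr 1
    ext k
    rw [hy.2.2 k j (by rw [hL]; linarith [abs_nonneg q]), mul_zero, zero_sub, neg_eq_zero]
    by_cases hk : k = j - q
    · rw [hy.2.2 i k, zero_mul, mul_zero]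
      rw [hk, hL]
      exact (abs_sub _ _).trans (by linarith)
    · rw [hx.1 k j hk, mul_zero, mul_zero]

namespace HatGlModule

variable {M : Type*} [AddCommGroup M] [Module ℂ M] (V : HatGlModule M)

/-! ### Words in homogeneous elements -/

theorem act_act {p q : ℤ} {x y : HatGl} (hx : x ∈ hatDeg p) (hy : y ∈ hatDeg q) (w : M) :
    V.act x (V.act y w)
      = V.act (hatBracket x y) w + (-1 : ℂ) ^ (p * q) • V.act y (V.act x w) := by
  have h := LinearMap.congr_fun (V.act_bracket p q x y hx hy) w
  simp only [LinearMap.sub_apply, LinearMap.smul_apply, Module.End.mul_apply] at h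
  rw [h, sub_add_cancel]

/-- A subspace stable under all homogeneous elements is a submodule for the whole superalgebra. -/
theorem act_mem_of_forall_hatDeg {W : Submodule ℂ M}
    (h : ∀ p : ℤ, ∀ x ∈ hatDeg p, ∀ w ∈ W, V.act x w ∈ W) (x : HatGl) :
    ∀ w ∈ W, V.act x w ∈ W := by
  have hx : x ∈ ⨆ p : ℤ, hatDeg p := iSup_hatDeg ▸ Submodule.mem_top
  induction hx using Submodule.iSup_induction' with
  | mem p x hx => exact h p x hx
  | zero => intro w _; simp
  | add a b _ _ ha hb =>
    intro w hw
    rw [map_add, LinearMap.add_apply]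
    exact Submodule.add_mem _ (ha w hw) (hb w hw)

theorem sum_degree_nonpos {l : List (ℤ × HatGl)} (h : ∀ y ∈ l, y.1 ≤ 0) :
    (l.map Prod.fst).sum ≤ 0 := by
  simpa using List.sum_le_card_nsmul (l.map Prod.fst) 0 (by simpa using h)

/-- The span of the vectors `x₁ ⋯ x_k u` with `x_i` homogeneous of degree in `S` and of total
degree `n`. -/
def wordSpan (S : Set ℤ) (u : M) (n : ℤ) : Submodule ℂ M :=
  Submodule.span ℂ {m | ∃ l : List (ℤ × HatGl), (∀ y ∈ l, y.1 ∈ S ∧ y.2 ∈ hatDeg y.1) ∧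
    (l.map Prod.fst).sum = n ∧ (l.map fun y => V.act y.2).prod u = m}

theorem self_mem_wordSpan (S : Set ℤ) (u : M) : u ∈ V.wordSpan S u 0 :=
  Submodule.subset_span ⟨[], by simp, rfl, rfl⟩

theorem act_mem_wordSpan {S : Set ℤ} {u : M} {p n : ℤ} (hp : p ∈ S) {x : HatGl}
    (hx : x ∈ hatDeg p) {m : M} (hm : m ∈ V.wordSpan S u n) :
    V.act x m ∈ V.wordSpan S u (p + n) := by
  rw [wordSpan] at hm
  induction hm using Submodule.span_induction with
  | mem m hm =>
    obtain ⟨l, hl, hs, rfl⟩ := hm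
    refine Submodule.subset_span ⟨(p, x) :: l, ?_, by simp [hs], by simp⟩
    intro y hy
    rcases List.mem_cons.1 hy with rfl | hy
    · exact ⟨hp, hx⟩
    · exact hl y hy
  | zero => rw [map_zero]; exact Submodule.zero_mem _
  | add a b _ _ ha hb => rw [map_add]; exact Submodule.add_mem _ ha hb
  | smul r a _ ha => rw [map_smul]; exact Submodule.smul_mem _ r ha

theorem act_mem_iSup_wordSpan {S : Set ℤ} {u : M} {p : ℤ} (hp : p ∈ S) {x : HatGl}
    (hx : x ∈ hatDeg p) {m : M} (hm : m ∈ ⨆ n, V.wordSpan S u n) :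
    V.act x m ∈ ⨆ n, V.wordSpan S u n := by
  induction hm using Submodule.iSup_induction' with
  | mem n m hm => exact Submodule.mem_iSup_of_mem _ (V.act_mem_wordSpan hp hx hm)
  | zero => rw [map_zero]; exact Submodule.zero_mem _
  | add a b _ _ ha hb => rw [map_add]; exact Submodule.add_mem _ ha hb

/-- The submodule generated by a vector killed by `𝔤₊` is spanned by the words whose letters have
degree `≤ 0`: a letter of positive degree can be commuted to the right until it acts by `0`. -/
theorem act_mem_iSup_wordSpan_of_singular {u : M}
    (hu : ∀ q : ℤ, 0 < q → ∀ x ∈ hatDeg q, V.act x u = 0) {q : ℤ} {x : HatGl}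
    (hx : x ∈ hatDeg q) {m : M} (hm : m ∈ ⨆ n, V.wordSpan (Set.Iic 0) u n) :
    V.act x m ∈ ⨆ n, V.wordSpan (Set.Iic 0) u n := by
  have word : ∀ l : List (ℤ × HatGl), (∀ y ∈ l, y.1 ∈ Set.Iic (0 : ℤ) ∧ y.2 ∈ hatDeg y.1) →
      ∀ (q : ℤ), ∀ x ∈ hatDeg q, V.act x ((l.map fun y => V.act y.2).prod u)
        ∈ ⨆ n, V.wordSpan (Set.Iic 0) u n := by
    intro l
    induction l with
    | nil =>
      intro _ q x hx
      rcases le_or_gt q 0 with hq | hq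
      · exact V.act_mem_iSup_wordSpan (Set.mem_Iic.2 hq) hx
          (Submodule.mem_iSup_of_mem 0 (V.self_mem_wordSpan _ u))
      · simp [hu q hq x hx]
    | cons y l ih =>
      intro hl q x hx
      have ih := ih fun z hz => hl z (List.mem_cons_of_mem _ hz)
      have hy := hl y List.mem_cons_self
      rw [List.map_cons, List.prod_cons, Module.End.mul_apply, V.act_act hx hy.2]
      exact Submodule.add_mem _ (ih _ _ (hatBracket_mem_hatDeg hx hy.2))
        (Submodule.smul_mem _ _ (V.act_mem_iSup_wordSpan hy.1 hy.2 (ih q x hx)))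
  induction hm using Submodule.iSup_induction' with
  | mem n m hm =>
    rw [wordSpan] at hm
    induction hm using Submodule.span_induction with
    | mem m hm =>
      obtain ⟨l, hl, -, rfl⟩ := hm
      exact word l hl q x hx
    | zero => rw [map_zero]; exact Submodule.zero_mem _
    | add a b _ _ ha hb => rw [map_add]; exact Submodule.add_mem _ ha hb
    | smul r a _ ha => rw [map_smul]; exact Submodule.smul_mem _ r ha
  | zero => rw [map_zero]; exact Submodule.zero_mem _
  | add a b _ _ ha hb => rw [map_add]; exact Submodule.add_mem _ ha hb

variable {V} {ξ : Module.Dual ℂ (hatDeg 0)} {v : M}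

theorem mem_naturalGrading_zero : v ∈ V.naturalGrading v 0 :=
  Submodule.subset_span ⟨[], by simp, rfl, rfl⟩

theorem wordSpan_le_naturalGrading (hv : V.IsHighestWeight ξ v) (S : Set ℤ) {u : M} {n : ℤ}
    (hu : u ∈ V.naturalGrading v n) (k : ℤ) :
    V.wordSpan S u k ≤ V.naturalGrading v (k + n) := by
  refine Submodule.span_le.2 ?_
  rintro m ⟨l, hl, rfl, rfl⟩
  rw [SetLike.mem_coe]
  induction l with
  | nil => simpa using hu
  | cons y l ih =>
    simp only [List.map_cons, List.prod_cons, Module.End.mul_apply, List.sum_cons, add_assoc]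
    exact (V.naturalGrading_isGrading hv).2 _ _ _ (hl y List.mem_cons_self).2 _
      (ih fun z hz => hl z (List.mem_cons_of_mem _ hz))

/-- A vector of negative degree killed by `𝔤₊` generates a submodule not containing the highest
weight vector, so in an irreducible module it is `0`. -/
theorem eq_zero_of_singular (hirr : V.IsIrreducible) (hv : V.IsHighestWeight ξ v) {n : ℤ}
    (hn : n < 0) {u : M} (hun : u ∈ V.naturalGrading v n)
    (hu : ∀ q : ℤ, 0 < q → ∀ x ∈ hatDeg q, V.act x u = 0) : u = 0 := by
  have hmem : u ∈ ⨆ k, V.wordSpan (Set.Iic 0) u k :=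
    Submodule.mem_iSup_of_mem 0 (V.self_mem_wordSpan _ u)
  rcases hirr.2 _ (V.act_mem_of_forall_hatDeg fun p x hx w hw =>
    V.act_mem_iSup_wordSpan_of_singular hu hx hw) with h | h
  · rwa [h, Submodule.mem_bot] at hmem
  · refine (hv.ne_zero ?_).elim
    have hle : (⨆ k, V.wordSpan (Set.Iic 0) u k) ≤ ⨆ j, ⨆ _ : j ≠ 0, V.naturalGrading v j := by
      refine iSup_le fun k => ?_
      rcases le_or_gt k 0 with hk | hk
      · exact (wordSpan_le_naturalGrading hv _ hun k).trans
          (le_iSup₂_of_le (k + n) (by omega) le_rfl)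
      · refine Submodule.span_le.2 ?_
        rintro m ⟨l, hl, hs, rfl⟩
        have : (l.map Prod.fst).sum ≤ 0 := sum_degree_nonpos fun z hz => (hl z hz).1
        omega
    have hind := (DirectSum.isInternal_submodule_iff_iSupIndep_and_iSup_eq_top _).1
      (V.naturalGrading_isGrading hv).1
    exact Submodule.disjoint_def.1 (hind.1 0) v mem_naturalGrading_zero
      (hle (h ▸ Submodule.mem_top))

/-- By `M = U(𝔤₋) v`, the natural grading is already spanned by the words with letters of negative
degree. -/
theorem naturalGrading_eq_wordSpan (hv : V.IsHighestWeight ξ v) (n : ℤ) :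
    V.naturalGrading v n = V.wordSpan (Set.Iio 0) v n := by
  have hle : ∀ k, V.wordSpan (Set.Iio 0) v k ≤ V.naturalGrading v k := fun k => by
    simpa using wordSpan_le_naturalGrading hv (Set.Iio 0) (mem_naturalGrading_zero (V := V)) k
  have hind := (DirectSum.isInternal_submodule_iff_iSupIndep_and_iSup_eq_top _).1
    (V.naturalGrading_isGrading hv).1
  have htop : ⨆ k, V.wordSpan (Set.Iio 0) v k = ⊤ := by
    rw [eq_top_iff]
    rintro m -
    obtain ⟨a, ha, rfl⟩ := hv.gen m
    have key : ∀ w ∈ ⨆ k, V.wordSpan (Set.Iio 0) v k, a w ∈ ⨆ k, V.wordSpan (Set.Iio 0) v k := by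
      induction ha using Algebra.adjoin_induction with
      | mem a ha =>
        obtain ⟨x, hx, rfl⟩ := ha
        rw [SetLike.mem_coe, hatNeg] at hx
        induction hx using Submodule.iSup_induction' with
        | mem p x hx => exact fun w hw => V.act_mem_iSup_wordSpan (Set.mem_Iio.2 p.2) hx hw
        | zero => intro w _; simp
        | add a b _ _ ha hb =>
          intro w hw
          rw [map_add, LinearMap.add_apply]
          exact Submodule.add_mem _ (ha w hw) (hb w hw)
      | algebraMap r =>
        intro w hw
        rw [Module.algebraMap_end_apply]
        exact Submodule.smul_mem _ r hw
      | add a b _ _ ha hb => exact fun w hw => Submodule.add_mem _ (ha w hw) (hb w hw)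
      | mul a b _ _ ha hb => exact fun w hw => ha _ (hb w hw)
    exact key v (Submodule.mem_iSup_of_mem 0 (V.self_mem_wordSpan _ v))
  refine le_antisymm (fun m hm => ?_) (hle n)
  have hm' : m ∈ V.wordSpan (Set.Iio 0) v n ⊔ ⨆ k, ⨆ _ : k ≠ n, V.wordSpan (Set.Iio 0) v k := by
    rw [← iSup_split_single, htop]
    exact Submodule.mem_top
  obtain ⟨a, ha, b, hb, rfl⟩ := Submodule.mem_sup.1 hm'
  have hb' : b ∈ V.naturalGrading v n := by
    simpa using sub_mem hm (hle n ha)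
  have : b = 0 := Submodule.disjoint_def.1 (hind.1 n) b hb' (iSup₂_mono (fun k _ => hle k) hb)
  rwa [this, add_zero]

/-! ### Finite weights give quasi-finite modules -/

theorem finiteDimensional_degApply {p : ℤ} {w : M} {L : ℕ}
    (h : ∀ x ∈ tailDeg p L, V.act x w = 0) : FiniteDimensional ℂ (V.degApply p w) := by
  let e : ℤ → HatGl := fun j => band p (Pi.single j 1)
  have hle : V.degApply p w ≤ Submodule.span ℂ
      (((fun j => V.act (e j) w) '' Finset.Icc (-L : ℤ) L) ∪ {V.act (0, 1) w}) := by
    rintro _ ⟨x, hx, rfl⟩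
    have h0 := h _ (sub_window_mem_tailDeg L hx)
    rw [map_sub, LinearMap.sub_apply, sub_eq_zero] at h0
    rw [LinearMap.flip_apply, h0, map_add, LinearMap.add_apply, map_sum, LinearMap.sum_apply,
      map_smul, LinearMap.smul_apply]
    refine Submodule.add_mem _ (Submodule.sum_mem _ fun j hj => ?_)
      (Submodule.smul_mem _ _ (Submodule.subset_span (Or.inr rfl)))
    rw [map_smul, LinearMap.smul_apply]
    exact Submodule.smul_mem _ _ (Submodule.subset_span (Or.inl ⟨j, hj, rfl⟩))
  have : FiniteDimensional ℂ (Submodule.span ℂ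
      (((fun j => V.act (e j) w) '' Finset.Icc (-L : ℤ) L) ∪ {V.act (0, 1) w})) :=
    FiniteDimensional.span_of_finite ℂ
      (((Finset.finite_toSet _).image _).union (Set.finite_singleton _))
  exact Submodule.finiteDimensional_of_le hle

theorem act_eq_zero_of_pos (hv : V.IsHighestWeight ξ v) {q : ℤ} (hq : 0 < q) {x : HatGl}
    (hx : x ∈ hatDeg q) : V.act x v = 0 :=
  hv.pos x (Submodule.mem_iSup_of_mem (p := fun p : {p : ℤ // 0 < p} => hatDeg p) ⟨q, hq⟩ hx)

/-- If the weight vanishes on diagonal matrices supported outside a window, then in every degree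
the matrices supported outside a suitable window kill the highest weight vector. In degree `-n` such
an element gives a vector on which `𝔤₊` acts by lower instances of the claim. -/
theorem exists_tailDeg_act_eq_zero (hirr : V.IsIrreducible) (hv : V.IsHighestWeight ξ v) {K : ℕ}
    (hK : ∀ h : hatDeg 0, (h : HatGl) ∈ tailDeg 0 K → ξ h = 0) (n : ℕ) :
    ∃ L, ∀ x ∈ tailDeg (-n) L, V.act x v = 0 := by
  -- passing from `n = k + q` to `k` costs a window of size `q ≤ n * n - k * k`
  refine ⟨K + n * n, ?_⟩
  induction n using Nat.strong_induction_on with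
  | _ n ih =>
    intro x hx
    rcases Nat.eq_zero_or_pos n with rfl | hn
    · rw [hv.weight ⟨x, hx.1⟩, hK ⟨x, hx.1⟩ (by simpa using hx), zero_smul]
    refine eq_zero_of_singular hirr hv (n := -(n : ℤ)) (by omega) ?_ fun q hq y hy => ?_
    · simpa using (V.naturalGrading_isGrading hv).2 _ 0 x hx.1 v mem_naturalGrading_zero
    rw [V.act_act hy hx.1, act_eq_zero_of_pos hv hq hy, map_zero, smul_zero, add_zero]
    rcases lt_or_ge (n : ℤ) q with h | h
    · exact act_eq_zero_of_pos hv (by omega) (hatBracket_mem_hatDeg hy hx.1)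
    · lift q to ℕ using hq.le
      obtain ⟨k, rfl⟩ := Nat.exists_eq_add_of_le (show q ≤ n by omega)
      refine ih k (by omega) _ ?_
      have := hatBracket_mem_tailDeg (L := K + k * k) hy (tailDeg_anti _ ?_ hx)
      · have e : (q : ℤ) + -((q + k : ℕ) : ℤ) = -k := by push_cast; ring
        rwa [e] at this
      · rw [Int.natAbs_natCast]
        nlinarith

/-- The same for every vector, since the vectors with this property form a submodule. -/
theorem exists_tailDeg_act_eq_zero_of_vector (hirr : V.IsIrreducible)
    (hv : V.IsHighestWeight ξ v) {K : ℕ}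
    (hK : ∀ h : hatDeg 0, (h : HatGl) ∈ tailDeg 0 K → ξ h = 0) (w : M) (p : ℤ) :
    ∃ L, ∀ x ∈ tailDeg p L, V.act x w = 0 := by
  let W : Submodule ℂ M :=
    { carrier := {w | ∀ p, ∃ L, ∀ x ∈ tailDeg p L, V.act x w = 0}
      zero_mem' := fun p => ⟨0, fun x _ => map_zero _⟩
      add_mem' := by
        intro a b ha hb p
        obtain ⟨L, hL⟩ := ha p
        obtain ⟨L', hL'⟩ := hb p
        refine ⟨max L L', fun x hx => ?_⟩
        rw [map_add, hL x (tailDeg_anti p (le_max_left _ _) hx),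
          hL' x (tailDeg_anti p (le_max_right _ _) hx), add_zero]
      smul_mem' := by
        intro r a ha p
        obtain ⟨L, hL⟩ := ha p
        exact ⟨L, fun x hx => by rw [map_smul, hL x hx, smul_zero]⟩ }
  have hvW : v ∈ W := by
    intro p
    rcases le_or_gt p 0 with hp | hp
    · obtain ⟨n, hn⟩ := Int.exists_eq_neg_ofNat hp
      rw [hn]
      exact exists_tailDeg_act_eq_zero hirr hv hK n
    · exact ⟨0, fun x hx => act_eq_zero_of_pos hv hp hx.1⟩
  have hW : ∀ q : ℤ, ∀ y ∈ hatDeg q, ∀ w ∈ W, V.act y w ∈ W := by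
    intro q y hy w hw p
    obtain ⟨L, hL⟩ := hw p
    obtain ⟨L', hL'⟩ := hw (q + p)
    refine ⟨max L (L' + q.natAbs), fun x hx => ?_⟩
    have h := V.act_act hy hx.1 w
    rw [hL x (tailDeg_anti p (le_max_left _ _) hx), map_zero,
      hL' _ (hatBracket_mem_tailDeg hy (tailDeg_anti p (le_max_right _ _) hx)), zero_add] at h
    exact (smul_eq_zero.1 h.symm).resolve_left (zpow_ne_zero _ (by norm_num))
  rcases hirr.2 W (V.act_mem_of_forall_hatDeg hW) with h | h
  · rw [h, Submodule.mem_bot] at hvW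
    exact (hv.ne_zero hvW).elim
  · exact (h ▸ Submodule.mem_top : w ∈ W) p

theorem finiteDimensional_map₂ {p : ℤ} (h : ∀ w, FiniteDimensional ℂ (V.degApply p w))
    (F : Submodule ℂ M) [hF : FiniteDimensional ℂ F] :
    FiniteDimensional ℂ (Submodule.map₂ V.act (hatDeg p) F : Submodule ℂ M) := by
  obtain ⟨s, rfl⟩ := (Submodule.fg_iff_finiteDimensional F).2 hF
  rw [show (s : Set M) = ⋃ w : s, {(w : M)} by ext; simp, Submodule.span_iUnion,
    Submodule.map₂_iSup_right]
  have : ∀ w : s, FiniteDimensional ℂ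
      (Submodule.map₂ V.act (hatDeg p) (Submodule.span ℂ {(w : M)}) : Submodule ℂ M) := by
    intro w
    rw [Submodule.map₂_span_singleton_eq_map_flip]
    exact h w
  infer_instance

/-- The component of degree `-n` lies in the sum of `ℂ v` (from the empty word) and the finitely
many spaces `𝔤_{k-n} M_{-k}` with `k < n`. -/
theorem finiteDimensional_wordSpan (h : ∀ p w, FiniteDimensional ℂ (V.degApply p w)) (n : ℕ) :
    FiniteDimensional ℂ (V.wordSpan (Set.Iio 0) v (-n)) := by
  induction n using Nat.strong_induction_on with
  | _ n ih =>
    have hfin : ∀ k : Fin n, FiniteDimensional ℂ (Submodule.map₂ V.act (hatDeg (k - n))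
        (V.wordSpan (Set.Iio 0) v (-(k : ℕ))) : Submodule ℂ M) := fun k => by
      have := ih k k.2
      exact finiteDimensional_map₂ (h _) _
    have hle : V.wordSpan (Set.Iio 0) v (-n) ≤ Submodule.span ℂ {v} ⊔
        ⨆ k : Fin n, Submodule.map₂ V.act (hatDeg (k - n))
          (V.wordSpan (Set.Iio 0) v (-(k : ℕ))) := by
      refine Submodule.span_le.2 ?_
      rintro m ⟨l, hl, hs, rfl⟩
      rcases l with _ | ⟨y, l⟩
      · exact Submodule.mem_sup_left (Submodule.mem_span_singleton_self v)
      have hy := hl y List.mem_cons_self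
      have hl' : ∀ z ∈ l, z.1 ∈ Set.Iio (0 : ℤ) ∧ z.2 ∈ hatDeg z.1 :=
        fun z hz => hl z (List.mem_cons_of_mem _ hz)
      have hsum : (l.map Prod.fst).sum ≤ 0 :=
        sum_degree_nonpos fun z hz => (Set.mem_Iio.1 (hl' z hz).1).le
      obtain ⟨k, hk⟩ := Int.exists_eq_neg_ofNat hsum
      have hy0 : y.1 < 0 := hy.1
      rw [List.map_cons, List.sum_cons, hk] at hs
      refine Submodule.mem_sup_right (Submodule.mem_iSup_of_mem ⟨k, by omega⟩ ?_)
      rw [List.map_cons, List.prod_cons, Module.End.mul_apply]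
      refine Submodule.apply_mem_map₂ _ ?_ (Submodule.subset_span ⟨l, hl', hk, rfl⟩)
      rw [show ((k : ℕ) : ℤ) - n = y.1 by omega]
      exact hy.2
    exact Submodule.finiteDimensional_of_le hle

theorem isQuasiFinite_of_weight (hirr : V.IsIrreducible) (hv : V.IsHighestWeight ξ v) {K : ℕ}
    (hK : ∀ h : hatDeg 0, (h : HatGl) ∈ tailDeg 0 K → ξ h = 0) : V.IsQuasiFinite v := by
  intro n
  rw [naturalGrading_eq_wordSpan hv]
  rcases le_or_gt n 0 with hn | hn
  · obtain ⟨k, rfl⟩ := Int.exists_eq_neg_ofNat hn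
    refine finiteDimensional_wordSpan (fun p w => ?_) k
    obtain ⟨L, hL⟩ := exists_tailDeg_act_eq_zero_of_vector hirr hv hK w p
    exact finiteDimensional_degApply hL
  · have : V.wordSpan (Set.Iio 0) v n = ⊥ := by
      refine le_bot_iff.1 (Submodule.span_le.2 ?_)
      rintro m ⟨l, hl, hs, rfl⟩
      have : (l.map Prod.fst).sum ≤ 0 :=
        sum_degree_nonpos fun z hz => (Set.mem_Iio.1 (hl z hz).1).le
      omega
    rw [this]
    infer_instance

/-! ### Finite-dimensionality in degree `-1/2` forces a finite weight -/

/-- The two-term recursion is solved outwards from `0`, so the solution vanishes wherever the right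
hand side vanishes on a window around `0`. -/
theorem exists_add_eq (K : ℕ) (h : ℤ → ℂ) (hh : ∀ j : ℤ, |j| ≤ K → h j = 0) :
    ∃ c : ℤ → ℂ, (∀ j, c j + c (j - 1) = h j) ∧ ∀ j : ℤ, |j| ≤ K → c j = 0 := by
  let u : ℕ → ℂ := fun n => Nat.rec 0 (fun k t => h (k + 1) - t) n
  let d : ℕ → ℂ := fun n => Nat.rec 0 (fun k t => h (-(k + 1)) - t) n
  have hu : ∀ n ≤ K, u n = 0 := by
    intro n
    induction n with
    | zero => exact fun _ => rfl
    | succ k ih =>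
      intro hk
      change h (k + 1) - u k = 0
      rw [ih (by omega), hh _ (abs_le.2 ⟨by omega, by omega⟩), sub_zero]
  have hd : ∀ n ≤ K, d n = 0 := by
    intro n
    induction n with
    | zero => exact fun _ => rfl
    | succ k ih =>
      intro hk
      change h (-(k + 1)) - d k = 0
      rw [ih (by omega), hh _ (abs_le.2 ⟨by omega, by omega⟩), sub_zero]
  refine ⟨fun j => if 0 ≤ j then u j.toNat else d (-j - 1).toNat, fun j => ?_, fun j hj => ?_⟩
  · rcases lt_trichotomy j 0 with hj | rfl | hj
    · obtain ⟨k, rfl⟩ := Int.exists_eq_neg_ofNat hj.le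
      obtain ⟨k, rfl⟩ := Nat.exists_eq_succ_of_ne_zero (show k ≠ 0 by rintro rfl; simp at hj)
      simp only [if_neg hj.not_ge, if_neg (show ¬ (0 : ℤ) ≤ -(k.succ : ℕ) - 1 by omega)]
      rw [show (-(-((k.succ : ℕ) : ℤ)) - 1).toNat = k by omega,
        show (-(-((k.succ : ℕ) : ℤ) - 1) - 1).toNat = k + 1 by omega]
      change d k + (h (-(k + 1)) - d k) = _
      rw [add_sub_cancel]
      push_cast
      rfl
    · simp [u, d, hh 0 (by simp)]
    · lift j to ℕ using hj.le
      obtain ⟨k, rfl⟩ := Nat.exists_eq_succ_of_ne_zero (show j ≠ 0 by rintro rfl; simp at hj)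
      simp only [if_pos hj.le, if_pos (show (0 : ℤ) ≤ (k.succ : ℕ) - 1 by omega)]
      rw [show (((k.succ : ℕ) : ℤ)).toNat = k + 1 by omega,
        show (((k.succ : ℕ) : ℤ) - 1).toNat = k by omega]
      change h (k + 1) - u k + u k = _
      rw [sub_add_cancel]
      push_cast
      rfl
  · rw [abs_le] at hj
    dsimp only
    split_ifs with h0
    · exact hu _ (by omega)
    · exact hd _ (by omega)

/-- The elements of `𝔤_{-1/2}` with entries `P(j)`, `P` a polynomial, form an infinite-dimensional
space, so one of them with `P ≠ 0` kills `v`; only finitely many of its entries vanish. -/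
theorem exists_polynomial_act_eq_zero (hfd : FiniteDimensional ℂ (V.degApply (-1) v)) :
    ∃ P : Polynomial ℂ, P ≠ 0 ∧ V.act (band (-1) fun j => P.eval (j : ℂ)) v = 0 := by
  let f : Polynomial ℂ →ₗ[ℂ] V.degApply (-1) v :=
    { toFun P := ⟨V.act (band (-1) fun j => P.eval (j : ℂ)) v, _, band_mem _ _, rfl⟩
      map_add' P Q := Subtype.ext <| by
        have : (fun j : ℤ => (P + Q).eval (j : ℂ))
            = (fun j : ℤ => P.eval (j : ℂ)) + fun j : ℤ => Q.eval (j : ℂ) := by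
          ext j; simp
        simp only [this, map_add, LinearMap.add_apply, Submodule.coe_add]
      map_smul' r P := Subtype.ext <| by
        have : (fun j : ℤ => (r • P).eval (j : ℂ)) = r • fun j : ℤ => P.eval (j : ℂ) := by
          ext j; simp
        simp only [this, map_smul, LinearMap.smul_apply, Submodule.coe_smul, RingHom.id_apply] }
  have hf : ¬ Function.Injective f := fun hf =>
    Polynomial.not_finite (R := ℂ) (Module.Finite.of_injective f hf)
  rw [← LinearMap.ker_eq_bot, Submodule.eq_bot_iff] at hf
  push Not at hf
  obtain ⟨P, hP, hP0⟩ := hf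
  exact ⟨P, hP0, congrArg Subtype.val (LinearMap.mem_ker.1 hP)⟩

/-- If an element of `𝔤_{-1/2}` kills `v`, so does its anticommutator with any element of
`𝔤_{1/2}`, which is diagonal; outside a window these anticommutators exhaust the diagonal
matrices. -/
theorem weight_eq_zero_of_mem_tailDeg (hv : V.IsHighestWeight ξ v)
    (hfd : FiniteDimensional ℂ (V.degApply (-1) v)) :
    ∃ K : ℕ, ∀ h : hatDeg 0, (h : HatGl) ∈ tailDeg 0 K → ξ h = 0 := by
  obtain ⟨P, hP, hPv⟩ := exists_polynomial_act_eq_zero hfd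
  have hfin : {j : ℤ | P.eval (j : ℂ) = 0}.Finite :=
    (Polynomial.finite_setOfPred_isRoot hP).preimage Int.cast_injective.injOn
  obtain ⟨K, hK⟩ : ∃ K : ℕ, ∀ j : ℤ, P.eval (j : ℂ) = 0 → |j| ≤ K := by
    obtain ⟨K, hK⟩ := (hfin.image Int.natAbs).bddAbove
    refine ⟨K, fun j hj => ?_⟩
    have := hK ⟨j, hj, rfl⟩
    rw [Int.abs_eq_natAbs]
    exact_mod_cast this
  refine ⟨K, fun h hh => ?_⟩
  obtain ⟨c, hc, hc0⟩ := exists_add_eq K (fun j => (h.1.1 : Matrix ℤ ℤ ℂ) j j)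
    fun j hj => hh.2.2 j j hj
  let b : ℤ → ℂ := fun j => c (j - 1) / P.eval ((j - 1 : ℤ) : ℂ)
  have hb : ∀ j : ℤ, P.eval (j : ℂ) * b (j + 1) = c j := by
    intro j
    simp only [b, add_sub_cancel_right]
    by_cases hj : P.eval (j : ℂ) = 0
    · rw [hj, zero_mul, hc0 j (hK j hj)]
    · exact mul_div_cancel₀ _ hj
  -- `h` is the anticommutator of `band 1 b` with the element given by `P`; both kill `v`
  have hbr : hatBracket (band 1 b) (band (-1) fun j => P.eval (j : ℂ)) = h := by
    have h1 : ∀ j : ℤ, P.eval (j : ℂ) * b (j + 1) + P.eval ((j - 1 : ℤ) : ℂ) * b j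
        = (h.1.1 : Matrix ℤ ℤ ℂ) j j := by
      intro j
      have := hb (j - 1)
      rw [sub_add_cancel] at this
      rw [hb, this, hc]
    have h2 := hb 0
    rw [zero_add, hc0 0 (by simp)] at h2
    rw [hatBracket_band_one_neg_one, eq_band h.2]
    simp only [h1, h2, hh.2.1, sub_zero]
  have hact := V.act_act (band_mem 1 b) (band_mem (-1) fun j => P.eval (j : ℂ)) v
  rw [hPv, act_eq_zero_of_pos hv one_pos (band_mem 1 b), hbr, map_zero, map_zero, smul_zero,
    add_zero, hv.weight] at hact
  exact (smul_eq_zero.1 hact.symm).resolve_right hv.ne_zero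

theorem exists_weight_eq_sum {K : ℕ}
    (hK : ∀ h : hatDeg 0, (h : HatGl) ∈ tailDeg 0 K → ξ h = 0) :
    ∃ (c : ℤ → ℂ) (d : ℂ), ξ = (∑ j ∈ Finset.Icc (-(2 * K : ℤ)) (2 * K : ℤ), c j • omega j)
      + d • Lambda0 := by
  let e : ℤ → hatDeg 0 := fun j => ⟨band 0 (Pi.single j 1), band_mem _ _⟩
  let z : hatDeg 0 := ⟨(0, 1), fun _ _ _ => rfl, fun h => (h rfl).elim⟩
  refine ⟨fun j => ξ (e j), ξ z, LinearMap.ext fun h => ?_⟩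
  let h' : hatDeg 0 := ∑ j ∈ Finset.Icc (-(2 * K : ℤ)) (2 * K : ℤ), omega j h • e j + Lambda0 h • z
  have hz : ξ (h - h') = 0 := by
    refine hK _ (tailDeg_anti 0 (show K ≤ 2 * K by omega) ?_)
    have := sub_window_mem_tailDeg (2 * K) h.2
    rw [Nat.cast_mul, Nat.cast_ofNat] at this
    convert this using 1
    simp only [h', e, z, Submodule.coe_sub, Submodule.coe_add, Submodule.coe_sum,
      Submodule.coe_smul, sub_zero]
    rfl
  rw [sub_eq_zero.1 ((ξ.map_sub h h').symm.trans hz)]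
  simp only [h', map_add, map_sum, map_smul, smul_eq_mul, LinearMap.add_apply,
    LinearMap.sum_apply, LinearMap.smul_apply]
  exact congrArg₂ _ (Finset.sum_congr rfl fun j _ => mul_comm _ _) (mul_comm _ _)

end HatGlModule

end SuperGl
end

theorem mainTheorem7 {M : Type*} [AddCommGroup M] [Module ℂ M] (V : SuperGl.HatGlModule M)
    (hirr : V.IsIrreducible) (ξ : Module.Dual ℂ (SuperGl.hatDeg 0)) (v : M)
    (hv : V.IsHighestWeight ξ v) :
    List.TFAE
      [V.IsQuasiFinite v,
       FiniteDimensional ℂ (V.degApply (-1) v),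
       ∃ (N : ℕ) (c : ℤ → ℂ) (d : ℂ),
         ξ = (∑ j ∈ Finset.Icc (-(2 * N : ℤ)) (2 * N : ℤ), c j • SuperGl.omega j)
           + d • SuperGl.Lambda0] := by
  tfae_have 1 → 2 := by
    intro h
    have := h (-1)
    refine Submodule.finiteDimensional_of_le (S₂ := V.naturalGrading v (-1)) ?_
    rintro _ ⟨x, hx, rfl⟩
    simpa using (V.naturalGrading_isGrading hv).2 (-1) 0 x hx v
      SuperGl.HatGlModule.mem_naturalGrading_zero
  tfae_have 2 → 3 := by
    intro h
    obtain ⟨K, hK⟩ := SuperGl.HatGlModule.weight_eq_zero_of_mem_tailDeg hv h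
    exact ⟨K, SuperGl.HatGlModule.exists_weight_eq_sum hK⟩
  tfae_have 3 → 1 := by
    rintro ⟨N, c, d, hξ⟩
    refine SuperGl.HatGlModule.isQuasiFinite_of_weight hirr hv (K := 2 * N) fun h hh => ?_
    rw [hξ, LinearMap.add_apply, LinearMap.sum_apply, LinearMap.smul_apply,
      show SuperGl.Lambda0 h = 0 from hh.2.1, smul_zero, add_zero]
    refine Finset.sum_eq_zero fun j hj => ?_
    rw [LinearMap.smul_apply, show SuperGl.omega j h = 0 from
      hh.2.2 j j (abs_le.2 (by push_cast; exact Finset.mem_Icc.1 hj)), smul_zero]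
  tfae_finish
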